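/- Rings are associative with identity, not necessarily commutative, and modules are unital. A ring $R$ is called semilocal if $R/J(R)$ is a semisimple artinian ring, where $J(R)$ is the Jacobson radical of $R$. If $R$ is a semilocal ring and $M$ is a finitely presented right $R$-module, then the endomorphism ring $\operatorname{End}(M_R)$ is semilocal. Finite presentation cannot be weakened to finite generation: there exist a semilocal ring $R$ and a finitely generated right $R$-module $M$ such that $\operatorname{End}(M_R)$ is not semilocal. -/

import Mathlib

universe u v

/-- A ring `R` (not necessarily commutative) is semilocal if `R / J(R)` is a semisimple artinian
ring, where `J(R)` is the Jacobson radical. (`IsSemisimpleRing S` says that `S` is semisimple as a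
module over itself; being generated by `1`, such a ring is automatically artinian.) -/
def IsSemilocalRing (R : Type*) [Ring R] : Prop :=
  IsSemisimpleRing (R ⧸ Ring.jacobson R)

/-!
**Positive part.** The engine is a form of the Camps–Dicks criterion: a ring `E` is semilocal as
soon as it acts, through a ring homomorphism `φ`, on a noetherian module `N` in such a way that `a`
is a unit whenever `φ a` is injective (`isSemilocalRing_of_isUnit_of_injective`). Indeed, given a
left ideal `A` of `E`, pick `x ∈ A` with `ker φ(1 - x)` maximal. Then `E(1 - x)` is a complement of
`A` modulo the Jacobson radical: if `t(1 - x) ∈ A`, then `x + (1 - x)t(1 - x) ∈ A`, and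
`1 - (x + (1 - x)t(1 - x)) = (1 - x)(1 - t(1 - x))` has a kernel containing both `ker φ(1 - x)` and
`ker φ(1 - t(1 - x))`, which meet trivially; by maximality the latter is zero, so `1 - t(1 - x)` is
a unit.

Let `A` be semilocal with radical `J`, and let `M = F ⧸ K` with `F` finite free and `K` finitely
generated. Every endomorphism of `M` lifts to an endomorphism of `F` preserving `K`, so `End M` is a
quotient of the ring `E` of such endomorphisms, and quotients of semilocal rings are semilocal. The
ring `E` acts on `F/JF × K/JK`, a finitely generated semisimple module. If `g ∈ E` acts injectively
there, it acts surjectively, so by Nakayama's lemma `g` is surjective on `F` and on `K`; as `F` is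
projective, `g` is moreover bijective on `F`, hence a unit of `E`. The finite generation of `K` makes
`K/JK` noetherian and Nakayama's lemma applicable to `K`. Right modules are reached through `Rᵐᵒᵖ`,
which is semilocal when `R` is.

**Counterexample.** For a field `k`, the ring of matrices `[[a, v], [0, b]]` with `a, v ∈ k(X)` and
`b ∈ k` is semilocal, since its diagonal map to `k(X) × k` reflects units. The cyclic right module
of rows `k(X) × k(X)/k[X]` has as endomorphisms exactly the multiplications by those `a ∈ k(X)` with
`a k[X] ⊆ k[X]`, so its endomorphism ring is `k[X]`, which has zero radical and is not artinian.
-/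

/-! ### Units and the Jacobson radical -/

theorem Ring.mem_jacobson_of_isUnit_one_sub_mul {E : Type*} [Ring E] {x : E}
    (h : ∀ r : E, IsUnit (1 - r * x)) : x ∈ Ring.jacobson E := by
  rw [← Ideal.jacobson_bot, Ideal.mem_jacobson_iff]
  intro y
  obtain ⟨z, hz⟩ := (h (-y)).exists_left_inv
  refine ⟨z, ?_⟩
  rw [Ideal.mem_bot, ← hz]
  noncomm_ring

theorem Ring.isUnit_one_add_of_mem_jacobson {E : Type*} [Ring E] {x : E}
    (hx : x ∈ Ring.jacobson E) : IsUnit (1 + x) := by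
  have key : ∀ y ∈ Ring.jacobson E, ∃ z, z * (1 + y) = 1 := by
    intro y hy
    rw [← Ideal.jacobson_bot, Ideal.mem_jacobson_iff] at hy
    obtain ⟨z, hz⟩ := hy 1
    rw [Ideal.mem_bot, sub_eq_zero] at hz
    exact ⟨z, by rw [mul_one] at hz; rw [mul_add, mul_one, add_comm, hz]⟩
  obtain ⟨z, hz⟩ := key x hx
  obtain ⟨w, hw⟩ := key (-(z * x)) (neg_mem (Ideal.mul_mem_left _ z hx))
  have hz' : 1 + -(z * x) = z := by rw [← hz]; noncomm_ring
  rw [hz'] at hw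
  have hwx : w = 1 + x := by
    calc w = w * (z * (1 + x)) := by rw [hz, mul_one]
      _ = 1 + x := by rw [← mul_assoc, hw, one_mul]
  exact ⟨⟨1 + x, z, hwx ▸ hw, hz⟩, rfl⟩

/-- An element that is a unit modulo `J(E)` is a unit. -/
theorem isLocalHom_quotient_mk_jacobson (E : Type*) [Ring E] :
    IsLocalHom (Ideal.Quotient.mk (Ring.jacobson E)) := by
  refine ⟨fun a ha ↦ ?_⟩
  obtain ⟨b, hb, hb'⟩ := isUnit_iff_exists.mp ha
  obtain ⟨b, rfl⟩ := Ideal.Quotient.mk_surjective b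
  have unit_of (c : E) (hc : Ideal.Quotient.mk (Ring.jacobson E) c = 1) : IsUnit c := by
    rw [← map_one (Ideal.Quotient.mk _), Ideal.Quotient.eq] at hc
    simpa using Ring.isUnit_one_add_of_mem_jacobson hc
  have h₁ : IsUnit (a * b) := unit_of _ (by rw [map_mul, hb])
  have h₂ : IsUnit (b * a) := unit_of _ (by rw [map_mul, hb'])
  obtain ⟨c, hc⟩ := h₁.exists_right_inv
  obtain ⟨d, hd⟩ := h₂.exists_left_inv
  rw [mul_assoc] at hc
  rw [← mul_assoc] at hd
  exact isUnit_iff_exists_and_exists.mpr ⟨⟨_, hc⟩, ⟨_, hd⟩⟩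

/-! ### The Camps–Dicks criterion -/

/-- Semisimplicity of `E ⧸ J(E)`, in terms of left ideals of `E`: each has a
complement up to `J(E)`. -/
theorem isSemilocalRing_of_exists_almost_complement {E : Type*} [Ring E]
    (h : ∀ A : Ideal E, ∃ B : Ideal E, A ⊔ B = ⊤ ∧ A ⊓ B ≤ Ring.jacobson E) :
    IsSemilocalRing E := by
  have hE : IsSemisimpleModule E (E ⧸ Ring.jacobson E) := by
    refine (isSemisimpleModule_iff _ _).mpr ⟨fun A ↦ ?_⟩
    obtain ⟨B, hsup, hinf⟩ := h (A.comap (Ring.jacobson E).mkQ)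
    refine ⟨Submodule.map (Ring.jacobson E).mkQ B, ?_, ?_⟩
    · rw [disjoint_iff, eq_bot_iff]
      rintro _ ⟨hA, b, hb, rfl⟩
      have : b ∈ Ring.jacobson E := hinf ⟨hA, hb⟩
      simpa using Ideal.Quotient.eq_zero_iff_mem.mpr this
    · rw [codisjoint_iff, ← Submodule.map_comap_eq_of_surjective
        (Ring.jacobson E).mkQ_surjective A, ← Submodule.map_sup, hsup, Submodule.map_top,
        Submodule.range_mkQ]
  -- `E`-submodules and left ideals of `E ⧸ J(E)` coincide.
  let f : E ⧸ Ring.jacobson E →ₛₗ[Ideal.Quotient.mk (Ring.jacobson E)] E ⧸ Ring.jacobson E :=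
    ⟨AddHom.id _, fun _ _ ↦ rfl⟩
  exact (f.isSemisimpleModule_iff_of_bijective Function.bijective_id).1 hE

/-- A ring acting on a noetherian module so that only units act injectively is semilocal. The
complement modulo the radical of a left ideal `A` is generated by `1 - x`, where `x ∈ A` is chosen
with the kernel of `1 - x` as large as possible. -/
theorem isSemilocalRing_of_isUnit_of_injective {E T N : Type*} [Ring E] [Ring T]
    [AddCommGroup N] [Module T N] [IsNoetherian T N] (φ : E →+* Module.End T N)
    (hφ : ∀ a, Function.Injective (φ a) → IsUnit a) : IsSemilocalRing E := by
  refine isSemilocalRing_of_exists_almost_complement fun A ↦ ?_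
  obtain ⟨_, ⟨x, hxA, rfl⟩, hmax⟩ := set_has_maximal_iff_noetherian.mpr ‹IsNoetherian T N›
    ((fun x ↦ LinearMap.ker (φ (1 - x))) '' (A : Set E)) ⟨_, 0, A.zero_mem, rfl⟩
  have unit_of (t : E) (ht : t * (1 - x) ∈ A) : IsUnit (1 - t * (1 - x)) := by
    refine hφ _ (LinearMap.ker_eq_bot.mp (eq_bot_iff.mpr fun n hn ↦ ?_))
    -- On the kernel of `1 - t * (1 - x)`, the action of `1 - x` is injective, with left inverse `t`.
    have hn' : n = φ t (φ (1 - x) n) := by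
      simpa only [map_sub, map_one, map_mul, LinearMap.mem_ker, LinearMap.sub_apply,
        Module.End.one_apply, Module.End.mul_apply, sub_eq_zero] using hn
    -- The competitor to `x` whose kernel contains both kernels.
    have hy : x + (1 - x) * (t * (1 - x)) ∈ A := A.add_mem hxA (A.mul_mem_left _ ht)
    have hfac : 1 - (x + (1 - x) * (t * (1 - x))) = (1 - (1 - x) * t) * (1 - x) := by
      noncomm_ring
    have hfac' : 1 - (x + (1 - x) * (t * (1 - x))) = (1 - x) * (1 - t * (1 - x)) := by
      noncomm_ring
    have hle : LinearMap.ker (φ (1 - x)) ≤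
        LinearMap.ker (φ (1 - (x + (1 - x) * (t * (1 - x))))) := by
      intro m hm
      rw [LinearMap.mem_ker] at hm ⊢
      rw [hfac, map_mul, Module.End.mul_apply, hm, map_zero]
    have hmem : n ∈ LinearMap.ker (φ (1 - (x + (1 - x) * (t * (1 - x))))) := by
      rw [LinearMap.mem_ker] at hn ⊢
      rw [hfac', map_mul, Module.End.mul_apply, hn, map_zero]
    rw [← hle.eq_of_not_lt (hmax _ ⟨_, hy, rfl⟩), LinearMap.mem_ker] at hmem
    rw [Submodule.mem_bot, hn', hmem, map_zero]
  refine ⟨Ideal.span {1 - x}, ?_, ?_⟩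
  · rw [Ideal.eq_top_iff_one]
    have h := Submodule.add_mem_sup hxA (Ideal.mem_span_singleton_self (1 - x))
    rwa [add_sub_cancel] at h
  · rintro y ⟨hyA, hyB⟩
    refine Ring.mem_jacobson_of_isUnit_one_sub_mul fun r ↦ ?_
    obtain ⟨t, rfl⟩ := Ideal.mem_span_singleton'.mp hyB
    rw [← mul_assoc]
    exact unit_of _ (by rw [mul_assoc]; exact A.mul_mem_left r hyA)

/-- The criterion of Camps and Dicks, applied to the action of `E` on `S` by left multiplication,
which is linear over `Sᵐᵒᵖ`. -/
theorem isSemilocalRing_of_isLocalHom {E S : Type*} [Ring E] [Ring S] [IsSemisimpleRing S]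
    (φ : E →+* S) [IsLocalHom φ] : IsSemilocalRing E := by
  have : Module.Finite Sᵐᵒᵖ S := .of_surjective (LinearMap.toSpanSingleton Sᵐᵒᵖ S 1)
    fun s ↦ ⟨.op s, one_mul s⟩
  refine isSemilocalRing_of_isUnit_of_injective
    ((Module.toModuleEnd Sᵐᵒᵖ (S := S) S).comp φ) fun a ha ↦ IsUnit.of_map φ a ?_
  obtain ⟨b, hb⟩ := IsArtinian.surjective_of_injective_endomorphism _ ha 1
  have hb : φ a * b = 1 := hb
  refine isUnit_iff_exists.mpr ⟨b, hb, ha ?_⟩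
  change φ a * (b * φ a) = φ a * 1
  rw [← mul_assoc, hb, one_mul, mul_one]

/-- The opposite of `R → R ⧸ J(R)` is again a unit-reflecting map to a semisimple ring. -/
theorem IsSemilocalRing.mulOpposite {R : Type*} [Ring R] (hR : IsSemilocalRing R) :
    IsSemilocalRing Rᵐᵒᵖ := by
  have : IsSemisimpleRing (R ⧸ Ring.jacobson R) := hR
  have hloc := isLocalHom_quotient_mk_jacobson R
  have : IsLocalHom (RingHom.op (Ideal.Quotient.mk (Ring.jacobson R))) := by
    refine ⟨fun a ha ↦ ?_⟩
    have h : IsUnit (Ideal.Quotient.mk (Ring.jacobson R) a.unop) := ha.unop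
    simpa using (IsUnit.of_map _ _ h).op
  exact isSemilocalRing_of_isLocalHom (RingHom.op (Ideal.Quotient.mk (Ring.jacobson R)))

theorem IsSemilocalRing.of_surjective {R S : Type*} [Ring R] [Ring S] (hR : IsSemilocalRing R)
    (f : R →+* S) (hf : Function.Surjective f) : IsSemilocalRing S := by
  have : IsSemisimpleRing (R ⧸ Ring.jacobson R) := hR
  have : RingHomSurjective f := ⟨hf⟩
  exact (Ideal.Quotient.lift (Ring.jacobson R) ((Ideal.Quotient.mk (Ring.jacobson S)).comp f)
    fun a ha ↦ Ideal.Quotient.eq_zero_iff_mem.mpr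
      (Ring.le_comap_jacobson f ha)).isSemisimpleRing_of_surjective
    (Ideal.Quotient.lift_surjective_of_surjective _ _
      (Ideal.Quotient.mk_surjective.comp hf))

/-! ### Finitely generated modules over a semilocal ring -/

theorem IsSemilocalRing.isSemisimpleModule_quotient_jacobson_smul {A : Type*} [Ring A]
    (hA : IsSemilocalRing A) (P : Type*) [AddCommGroup P] [Module A P] :
    IsSemisimpleModule A (P ⧸ Ring.jacobson A • (⊤ : Submodule A P)) := by
  have : IsSemisimpleRing (A ⧸ Ring.jacobson A) := hA
  have h : Module.IsTorsionBySet A (P ⧸ Ring.jacobson A • (⊤ : Submodule A P))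
      (Ring.jacobson A) :=
    (Module.isTorsionBySet_quotient_iff _ _).mpr
      fun m i hi ↦ Submodule.smul_mem_smul hi trivial
  let _ := h.module
  exact (h.semilinearMap.isSemisimpleModule_iff_of_bijective Function.bijective_id).2
    inferInstance

/-- The action of endomorphisms of `P` on `P ⧸ J(A)P`. -/
def Module.End.modJacobson (A P : Type*) [Ring A] [AddCommGroup P] [Module A P] :
    Module.End A P →+* Module.End A (P ⧸ Ring.jacobson A • (⊤ : Submodule A P)) where
  toFun f := Submodule.mapQ _ _ f <| by
    rw [← Submodule.map_le_iff_le_comap, Submodule.map_smul'']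
    exact smul_mono_right _ le_top
  map_one' := by ext; rfl
  map_mul' _ _ := by ext; rfl
  map_zero' := by ext; rfl
  map_add' _ _ := by ext; rfl

/-- Nakayama's lemma, applied to the cokernel of `f`. -/
theorem Module.End.surjective_of_surjective_modJacobson {A P : Type*} [Ring A] [AddCommGroup P]
    [Module A P] [Module.Finite A P] {f : Module.End A P}
    (hf : Function.Surjective (Module.End.modJacobson A P f)) : Function.Surjective f := by
  have hsup (y : P) : ∃ x, y - f x ∈ Ring.jacobson A • (⊤ : Submodule A P) := by
    obtain ⟨x, hx⟩ := hf (Submodule.Quotient.mk y)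
    obtain ⟨x, rfl⟩ := Submodule.Quotient.mk_surjective _ x
    exact ⟨x, (Submodule.Quotient.eq _).mp hx.symm⟩
  have hbot : (⊤ : Submodule A (P ⧸ LinearMap.range f)) = ⊥ := by
    refine Module.Finite.fg_top.eq_bot_of_le_jacobson_smul fun y _ ↦ ?_
    obtain ⟨y, rfl⟩ := Submodule.Quotient.mk_surjective _ y
    obtain ⟨x, hx⟩ := hsup y
    have h := Submodule.mem_map_of_mem (f := (LinearMap.range f).mkQ) hx
    rw [Submodule.map_smul'', Submodule.map_top, Submodule.range_mkQ, map_sub,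
      Submodule.mkQ_apply, Submodule.mkQ_apply,
      (Submodule.Quotient.mk_eq_zero _).mpr (LinearMap.mem_range_self f x), sub_zero] at h
    exact h
  have : Subsingleton (P ⧸ LinearMap.range f) :=
    (Submodule.subsingleton_iff A).mp (subsingleton_of_bot_eq_top hbot.symm)
  exact LinearMap.range_eq_top.mp (Submodule.Quotient.subsingleton_iff.mp this)

/-- `P ⧸ J(A)P` is semisimple and finitely generated, hence artinian, so its injective endomorphisms
are surjective. -/
theorem IsSemilocalRing.surjective_of_injective_modJacobson {A P : Type*} [Ring A]
    (hA : IsSemilocalRing A) [AddCommGroup P] [Module A P] [Module.Finite A P]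
    {f : Module.End A P} (hf : Function.Injective (Module.End.modJacobson A P f)) :
    Function.Surjective f := by
  have := hA.isSemisimpleModule_quotient_jacobson_smul P
  exact Module.End.surjective_of_surjective_modJacobson
    (IsArtinian.surjective_of_injective_endomorphism _ hf)

/-- By projectivity `f` has a right inverse `s`, which is injective modulo `J(A)` and therefore
surjective itself; this makes `f` injective. -/
theorem IsSemilocalRing.bijective_of_injective_modJacobson {A P : Type*} [Ring A]
    (hA : IsSemilocalRing A) [AddCommGroup P] [Module A P] [Module.Finite A P]
    [Module.Projective A P] {f : Module.End A P}
    (hf : Function.Injective (Module.End.modJacobson A P f)) : Function.Bijective f := by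
  have hsurj := hA.surjective_of_injective_modJacobson hf
  obtain ⟨s, hs⟩ := Module.projective_lifting_property f LinearMap.id hsurj
  have hs' : f * s = 1 := hs
  have hleft : Function.LeftInverse f s := LinearMap.congr_fun hs
  have hs_inj : Function.Injective (Module.End.modJacobson A P s) := by
    refine Function.LeftInverse.injective (g := Module.End.modJacobson A P f) fun x ↦ ?_
    rw [← Module.End.mul_apply, ← map_mul, hs', map_one, Module.End.one_apply]
  exact ⟨(hleft.rightInverse_of_surjective
    (hA.surjective_of_injective_modJacobson hs_inj)).injective, hsurj⟩

/-! ### Endomorphisms of a finitely presented module -/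

/-- The ring of endomorphisms of `F` that map `K` into itself. -/
def Submodule.stabilizerSubring {A F : Type*} [Ring A] [AddCommGroup F] [Module A F]
    (K : Submodule A F) : Subring (Module.End A F) where
  carrier := {g | K ≤ K.comap g}
  mul_mem' hf hg _ hx := hf (hg hx)
  one_mem' _ hx := hx
  add_mem' hf hg _ hx := K.add_mem (hf hx) (hg hx)
  zero_mem' _ _ := K.zero_mem
  neg_mem' hf _ hx := K.neg_mem (hf hx)

namespace Submodule

variable {A F : Type*} [Ring A] [AddCommGroup F] [Module A F] (K : Submodule A F)

/-- The action of the stabilizer of `K` on `K`. -/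
def stabilizerRestrict : K.stabilizerSubring →+* Module.End A K where
  toFun g := g.1.restrict g.2
  map_one' := rfl
  map_mul' _ _ := rfl
  map_zero' := rfl
  map_add' _ _ := rfl

/-- The action of the stabilizer of `K` on `F ⧸ K`. -/
def stabilizerMapQ : K.stabilizerSubring →+* Module.End A (F ⧸ K) where
  toFun g := K.mapQ K g.1 g.2
  map_one' := by ext; rfl
  map_mul' _ _ := by ext; rfl
  map_zero' := by ext; rfl
  map_add' _ _ := by ext; rfl

theorem stabilizerMapQ_surjective [Module.Projective A F] :
    Function.Surjective K.stabilizerMapQ := by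
  intro f
  obtain ⟨g, hg⟩ := Module.projective_lifting_property K.mkQ (f ∘ₗ K.mkQ) K.mkQ_surjective
  have hg' (x : F) : (K.mkQ (g x)) = f (K.mkQ x) := LinearMap.congr_fun hg x
  refine ⟨⟨g, fun x hx ↦ ?_⟩, ?_⟩
  · rw [mem_comap, ← Submodule.Quotient.mk_eq_zero, ← mkQ_apply, hg',
      mkQ_apply, (Submodule.Quotient.mk_eq_zero K).mpr hx, map_zero]
  · ext x
    exact hg' x

theorem isUnit_stabilizerSubring {g : K.stabilizerSubring} (hg : Function.Bijective g.1)
    (hK : Function.Surjective (K.stabilizerRestrict g)) : IsUnit g := by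
  let e := LinearEquiv.ofBijective g.1 hg
  have he (x : F) : g.1 (e.symm x) = x := e.apply_symm_apply x
  have he' (x : F) : e.symm (g.1 x) = x := e.symm_apply_apply x
  have hmem : e.symm.toLinearMap ∈ K.stabilizerSubring := by
    intro x hx
    obtain ⟨y, hy⟩ := hK ⟨x, hx⟩
    have hy : g.1 y = x := congrArg Subtype.val hy
    rw [mem_comap, ← hy, LinearEquiv.coe_coe, he']
    exact y.2
  exact isUnit_iff_exists.mpr ⟨⟨_, hmem⟩, Subtype.ext (LinearMap.ext he),
    Subtype.ext (LinearMap.ext he')⟩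

end Submodule

/-- The stabilizer of `K` acts on the noetherian module `F ⧸ J(A)F × K ⧸ J(A)K`, and only its units
act injectively. -/
theorem IsSemilocalRing.stabilizerSubring {A F : Type*} [Ring A] (hA : IsSemilocalRing A)
    [AddCommGroup F] [Module A F] [Module.Finite A F] [Module.Projective A F]
    {K : Submodule A F} (hK : K.FG) : IsSemilocalRing K.stabilizerSubring := by
  have : Module.Finite A K := Module.Finite.iff_fg.mpr hK
  have := hA.isSemisimpleModule_quotient_jacobson_smul F
  have := hA.isSemisimpleModule_quotient_jacobson_smul K
  refine isSemilocalRing_of_isUnit_of_injective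
    ((LinearMap.prodMapRingHom A (F ⧸ Ring.jacobson A • (⊤ : Submodule A F))
      (K ⧸ Ring.jacobson A • (⊤ : Submodule A K))).comp
      (((Module.End.modJacobson A F).comp K.stabilizerSubring.subtype).prod
        ((Module.End.modJacobson A K).comp K.stabilizerRestrict))) fun g hg ↦ ?_
  have hg' : Function.Injective (Prod.map (Module.End.modJacobson A F g.1)
    (Module.End.modJacobson A K (K.stabilizerRestrict g))) := hg
  rw [Prod.map_injective] at hg'
  exact K.isUnit_stabilizerSubring (hA.bijective_of_injective_modJacobson hg'.1)
    (hA.surjective_of_injective_modJacobson hg'.2)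

theorem IsSemilocalRing.moduleEnd_of_finitePresentation {A M : Type*} [Ring A]
    (hA : IsSemilocalRing A) [AddCommGroup M] [Module A M] [Module.FinitePresentation A M] :
    IsSemilocalRing (Module.End A M) := by
  obtain ⟨n, K, e, hK⟩ := Module.FinitePresentation.exists_fin A M
  refine (hA.stabilizerSubring hK).of_surjective
    ((e.symm.conjRingEquiv : _ →+* _).comp K.stabilizerMapQ) ?_
  exact e.symm.conjRingEquiv.surjective.comp K.stabilizerMapQ_surjective

/-! ### A finitely generated module whose endomorphism ring is not semilocal -/

noncomputable section

open Polynomial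

theorem not_isSemilocalRing_polynomial (k : Type*) [Field k] : ¬ IsSemilocalRing k[X] := by
  intro h
  have hJ : Ring.jacobson k[X] = ⊥ := by
    rw [← Ideal.jacobson_bot]
    have : IsJacobsonRing k[X] := inferInstance
    exact IsJacobsonRing.out ‹_› (Ideal.isPrime_bot (α := k[X])).isRadical
  have : IsSemisimpleRing (k[X] ⧸ Ring.jacobson k[X]) := h
  have : IsSemisimpleRing k[X] :=
    ((Ideal.quotEquivOfEq hJ).trans (RingEquiv.quotientBot k[X])).isSemisimpleRing
  exact Polynomial.not_isField k (IsArtinianRing.isField_of_isDomain k[X])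

/-- The ring of upper triangular matrices `[[a, v], [0, b]]` with `a` and `v` in `k(X)` and `b` in
`k`, encoded by its three entries. -/
@[ext]
structure RatTriangular (k : Type*) [Field k] where
  upperLeft : RatFunc k
  upperRight : RatFunc k
  lowerRight : k

namespace RatTriangular

variable {k : Type*} [Field k]

instance : Zero (RatTriangular k) := ⟨⟨0, 0, 0⟩⟩
instance : One (RatTriangular k) := ⟨⟨1, 0, 1⟩⟩
instance : Add (RatTriangular k) := ⟨fun r s ↦
  ⟨r.upperLeft + s.upperLeft, r.upperRight + s.upperRight, r.lowerRight + s.lowerRight⟩⟩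
instance : Neg (RatTriangular k) := ⟨fun r ↦ ⟨-r.upperLeft, -r.upperRight, -r.lowerRight⟩⟩
instance : Mul (RatTriangular k) := ⟨fun r s ↦
  ⟨r.upperLeft * s.upperLeft, r.upperLeft * s.upperRight + s.lowerRight • r.upperRight,
    r.lowerRight * s.lowerRight⟩⟩

@[simp] theorem upperLeft_zero : (0 : RatTriangular k).upperLeft = 0 := rfl
@[simp] theorem upperRight_zero : (0 : RatTriangular k).upperRight = 0 := rfl
@[simp] theorem lowerRight_zero : (0 : RatTriangular k).lowerRight = 0 := rfl
@[simp] theorem upperLeft_one : (1 : RatTriangular k).upperLeft = 1 := rfl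
@[simp] theorem upperRight_one : (1 : RatTriangular k).upperRight = 0 := rfl
@[simp] theorem lowerRight_one : (1 : RatTriangular k).lowerRight = 1 := rfl
@[simp] theorem upperLeft_add (r s : RatTriangular k) :
    (r + s).upperLeft = r.upperLeft + s.upperLeft := rfl
@[simp] theorem upperRight_add (r s : RatTriangular k) :
    (r + s).upperRight = r.upperRight + s.upperRight := rfl
@[simp] theorem lowerRight_add (r s : RatTriangular k) :
    (r + s).lowerRight = r.lowerRight + s.lowerRight := rfl
@[simp] theorem upperLeft_neg (r : RatTriangular k) : (-r).upperLeft = -r.upperLeft := rfl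
@[simp] theorem upperRight_neg (r : RatTriangular k) : (-r).upperRight = -r.upperRight := rfl
@[simp] theorem lowerRight_neg (r : RatTriangular k) : (-r).lowerRight = -r.lowerRight := rfl
@[simp] theorem upperLeft_mul (r s : RatTriangular k) :
    (r * s).upperLeft = r.upperLeft * s.upperLeft := rfl
@[simp] theorem upperRight_mul (r s : RatTriangular k) :
    (r * s).upperRight = r.upperLeft * s.upperRight + s.lowerRight • r.upperRight := rfl
@[simp] theorem lowerRight_mul (r s : RatTriangular k) :
    (r * s).lowerRight = r.lowerRight * s.lowerRight := rfl

instance : Ring (RatTriangular k) where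
  add_assoc _ _ _ := by ext1 <;> simp [add_assoc]
  zero_add _ := by ext1 <;> simp
  add_zero _ := by ext1 <;> simp
  add_comm _ _ := by ext1 <;> simp [add_comm]
  nsmul := nsmulRec
  zsmul := zsmulRec
  neg_add_cancel _ := by ext1 <;> simp
  mul_assoc _ _ _ := by
    ext1
    · simp [mul_assoc]
    · simp [Algebra.smul_def]; ring
    · simp [mul_assoc]
  one_mul _ := by ext1 <;> simp
  mul_one _ := by ext1 <;> simp
  zero_mul _ := by ext1 <;> simp
  mul_zero _ := by ext1 <;> simp
  left_distrib _ _ _ := by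
    ext1
    · simp [mul_add]
    · simp [mul_add, add_smul]; abel
    · simp [mul_add]
  right_distrib _ _ _ := by
    ext1
    · simp [add_mul]
    · simp [add_mul]; abel
    · simp [add_mul]

variable (k) in
/-- The diagonal of a triangular matrix. -/
def diagonal : RatTriangular k →+* RatFunc k × k where
  toFun r := (r.upperLeft, r.lowerRight)
  map_one' := rfl
  map_mul' _ _ := rfl
  map_zero' := rfl
  map_add' _ _ := rfl

instance : IsLocalHom (diagonal k) := by
  refine ⟨fun r hr ↦ ?_⟩
  obtain ⟨ha, hb⟩ := Prod.isUnit_iff.mp hr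
  have ha : r.upperLeft ≠ 0 := ha.ne_zero
  have hb : r.lowerRight ≠ 0 := hb.ne_zero
  refine isUnit_iff_exists.mpr
    ⟨⟨r.upperLeft⁻¹, -(r.lowerRight⁻¹ • (r.upperLeft⁻¹ * r.upperRight)), r.lowerRight⁻¹⟩, ?_, ?_⟩
  · ext1 <;> simp [ha, hb]
  · ext1 <;> simp [ha, hb]

variable (k) in
theorem isSemilocalRing : IsSemilocalRing (RatTriangular k) :=
  isSemilocalRing_of_isLocalHom (diagonal k)

variable (k) in
/-- The rows `(a, v)` with `a` in `k(X)` and `v` in `k(X) ⧸ k[X]`. Triangular matrices act on them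
from the right, by multiplication of a row with a matrix. -/
abbrev RowModule : Type _ :=
  RatFunc k × (RatFunc k ⧸ LinearMap.range (Algebra.linearMap k[X] (RatFunc k)))

instance : SMul (RatTriangular k)ᵐᵒᵖ (RowModule k) := ⟨fun r m ↦
  (m.1 * r.unop.upperLeft,
    Submodule.Quotient.mk (m.1 * r.unop.upperRight) + r.unop.lowerRight • m.2)⟩

theorem smul_def (r : (RatTriangular k)ᵐᵒᵖ) (m : RowModule k) :
    r • m = (m.1 * r.unop.upperLeft,
      Submodule.Quotient.mk (m.1 * r.unop.upperRight) + r.unop.lowerRight • m.2) := rfl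

instance : Module (RatTriangular k)ᵐᵒᵖ (RowModule k) where
  one_smul m := by simp [smul_def]
  mul_smul r s m := by
    ext1
    · simp [smul_def, mul_assoc]
    · simp [smul_def, mul_assoc, mul_smul, mul_add, Submodule.Quotient.mk_add,
        Submodule.Quotient.mk_smul, add_assoc, smul_comm r.unop.lowerRight s.unop.lowerRight]
  smul_zero r := by simp [smul_def]
  smul_add r m n := by
    ext1
    · simp [smul_def, add_mul]
    · simp [smul_def, add_mul]; abel
  add_smul r s m := by
    ext1
    · simp [smul_def, mul_add]
    · simp [smul_def, mul_add, add_smul]; abel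
  zero_smul m := by simp [smul_def]

/-- The row module is cyclic, generated by `(1, 0)`. -/
theorem exists_smul_eq (m : RowModule k) :
    ∃ r : (RatTriangular k)ᵐᵒᵖ, r • ((1, 0) : RowModule k) = m := by
  obtain ⟨a, u⟩ := m
  obtain ⟨v, rfl⟩ := Submodule.Quotient.mk_surjective _ u
  exact ⟨.op ⟨a, v, 0⟩, by simp [smul_def]⟩

instance : Module.Finite (RatTriangular k)ᵐᵒᵖ (RowModule k) :=
  .of_surjective (LinearMap.toSpanSingleton _ _ ((1, 0) : RowModule k)) exists_smul_eq

instance : SMulCommClass k[X] (RatTriangular k)ᵐᵒᵖ (RowModule k) where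
  smul_comm p r m := by
    ext1
    · simp [smul_def]
    · simp [smul_def, smul_comm p r.unop.lowerRight]

variable (k) in
/-- The endomorphisms of the row module are the multiplications by polynomials: an endomorphism is
determined by the image `(a, u)` of `(1, 0)`. Applying it to `(1, 0) = (1, 0) e₁₁` gives `u = 0`, and
applying it to `0 = (1, 0) e₁₂` gives `a ∈ k[X]`. -/
theorem toModuleEnd_bijective :
    Function.Bijective (Module.toModuleEnd (RatTriangular k)ᵐᵒᵖ (S := k[X]) (RowModule k)) := by
  constructor
  · intro p q h
    have h := congrArg Prod.fst (LinearMap.congr_fun h ((1, 0) : RowModule k))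
    simpa [Algebra.smul_def] using h
  · intro f
    obtain ⟨⟨a, u⟩, hau⟩ : ∃ m, f ((1, 0) : RowModule k) = m := ⟨_, rfl⟩
    have hu : u = 0 := by
      have h := f.map_smul (.op ⟨1, 0, 0⟩) ((1, 0) : RowModule k)
      rw [hau] at h
      simpa [smul_def, hau] using congrArg Prod.snd h
    have ha : (Submodule.Quotient.mk a :
        RatFunc k ⧸ LinearMap.range (Algebra.linearMap k[X] (RatFunc k))) = 0 := by
      have h := f.map_smul (.op ⟨0, 1, 0⟩) ((1, 0) : RowModule k)
      have h0 : (Submodule.Quotient.mk 1 :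
          RatFunc k ⧸ LinearMap.range (Algebra.linearMap k[X] (RatFunc k))) = 0 :=
        (Submodule.Quotient.mk_eq_zero _).mpr ⟨1, by simp⟩
      rw [hau] at h
      have hsmul :
          (MulOpposite.op ⟨0, 1, 0⟩ : (RatTriangular k)ᵐᵒᵖ) • ((1, 0) : RowModule k) = 0 := by
        simp only [smul_def, MulOpposite.unop_op, mul_zero, mul_one, h0, zero_smul, add_zero,
          Prod.mk_zero_zero]
      rw [hsmul, map_zero] at h
      have h := (congrArg Prod.snd h).symm
      simpa only [smul_def, MulOpposite.unop_op, mul_one, zero_smul, add_zero, Prod.snd_zero] using h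
    obtain ⟨p, rfl⟩ := (Submodule.Quotient.mk_eq_zero _).mp ha
    refine ⟨p, LinearMap.ext fun m ↦ ?_⟩
    obtain ⟨r, rfl⟩ := exists_smul_eq m
    rw [map_smul, map_smul, hau, hu]
    congr 1
    simp [Algebra.smul_def]

variable (k) in
theorem not_isSemilocalRing_moduleEnd :
    ¬ IsSemilocalRing (Module.End (RatTriangular k)ᵐᵒᵖ (RowModule k)) := fun h ↦
  not_isSemilocalRing_polynomial k <| h.of_surjective
    ((RingEquiv.ofBijective _ (toModuleEnd_bijective k)).symm : _ →+* k[X])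
    (RingEquiv.ofBijective _ (toModuleEnd_bijective k)).symm.surjective

end RatTriangular

end

/-! ### Finitely presented versus finitely generated modules -/

theorem theorem3p3 :
    (∀ (R : Type u) [Ring R] (M : Type v) [AddCommGroup M] [Module Rᵐᵒᵖ M],
      IsSemilocalRing R → Module.FinitePresentation Rᵐᵒᵖ M →
        IsSemilocalRing (Module.End Rᵐᵒᵖ M)) ∧
    (∃ (R : Type) (_ : Ring R) (M : Type) (_ : AddCommGroup M) (_ : Module Rᵐᵒᵖ M),
      IsSemilocalRing R ∧ Module.Finite Rᵐᵒᵖ M ∧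
        ¬ IsSemilocalRing (Module.End Rᵐᵒᵖ M)) :=
  ⟨fun _ _ _ _ _ hR _ ↦ hR.mulOpposite.moduleEnd_of_finitePresentation,
    RatTriangular ℚ, inferInstance, RatTriangular.RowModule ℚ, inferInstance, inferInstance,
    RatTriangular.isSemilocalRing ℚ, inferInstance,
    RatTriangular.not_isSemilocalRing_moduleEnd ℚ⟩
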